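/- Consider the class of cubic Schrödinger equations $$i\psi_t+\psi_{xx}+\psi^2\psi^*+V(t,x)\psi=0 \qquad (E_V)$$ for a complex-valued function $\psi$ of two real variables $t,x$, where $V$ is an arbitrary smooth complex-valued potential. Let $\Omega$ be a nonempty connected open subset of the space $\mathbb R\times\mathbb R\times\mathbb C$ of the variables $(t,x,\psi)$. The maximal Lie invariance algebra $A^{\max}(V)$ of $(E_V)$ on $\Omega$ consists of all smooth real vector fields $Q=\xi^t\partial_t+\xi^x\partial_x+\eta\,\partial_\psi+\eta^*\partial_{\psi^*}$ on $\Omega$ ($\xi^t,\xi^x$ real-valued, $\eta$ complex-valued, all three smooth functions of $(t,x,\psi,\psi^*)$) that satisfy the infinitesimal invariance criterion: the second prolongation of $Q$ annihilates the left-hand side of $(E_V)$ at every point over $\Omega$ of the submanifold of the second-order jet space defined by $(E_V)$. Let $A^{\ker}=\bigcap_V A^{\max}(V)$, the intersection over all smooth complex-valued potentials $V$ on the projection of $\Omega$ to the $(t,x)$-plane. Then $$A^{\ker}=\langle M\rangle,\qquad M=i(\psi\partial_\psi-\psi^*\partial_{\psi^*}),$$ the real span of $M$, and this algebra is one-dimensional.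 -/

import Mathlib

open scoped ContDiff ComplexConjugate

noncomputable section

namespace CubicSchrodinger

/-- The space of the variables `(t, x, ψ)`, with `t, x` real and `ψ` complex. -/
abbrev J0 : Type := ℝ × ℝ × ℂ

/-- The first jet space, with coordinates `((t, x, ψ), ψ_t, ψ_x)`. -/
abbrev J1 : Type := J0 × ℂ × ℂ

/-- The second jet space, with coordinates `(((t, x, ψ), ψ_t, ψ_x), ψ_tt, ψ_tx, ψ_xx)`. -/
abbrev J2 : Type := J1 × ℂ × ℂ × ℂ

/-- The derivative `ψ_t` as a coordinate on the first jet space. -/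
abbrev uT (j : J1) : ℂ := j.2.1

/-- The derivative `ψ_x` as a coordinate on the first jet space. -/
abbrev uX (j : J1) : ℂ := j.2.2

/-- The derivative `ψ_tt` as a coordinate on the second jet space. -/
abbrev uTT (j : J2) : ℂ := j.2.1

/-- The derivative `ψ_tx` as a coordinate on the second jet space. -/
abbrev uTX (j : J2) : ℂ := j.2.2.1

/-- The derivative `ψ_xx` as a coordinate on the second jet space. -/
abbrev uXX (j : J2) : ℂ := j.2.2.2

section TotalDerivatives

variable {G : Type} [NormedAddCommGroup G] [NormedSpace ℝ G]

/-- Total derivative `D_t F` of a function `F` of `(t, x, ψ, ψ*)`.  The real derivative in the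
direction `ψ_t` of the complex variable is `ψ_t ∂_ψ + ψ*_t ∂_ψ*`. -/
def totalT0 (F : J0 → G) (j : J1) : G := fderiv ℝ F j.1 (1, 0, uT j)

/-- Total derivative `D_x F` of a function `F` of `(t, x, ψ, ψ*)`. -/
def totalX0 (F : J0 → G) (j : J1) : G := fderiv ℝ F j.1 (0, 1, uX j)

/-- Total derivative `D_t F` of a function `F` on the first jet space. -/
def totalT1 (F : J1 → G) (j : J2) : G := fderiv ℝ F j.1 ((1, 0, uT j.1), uTT j, uTX j)

/-- Total derivative `D_x F` of a function `F` on the first jet space. -/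
def totalX1 (F : J1 → G) (j : J2) : G := fderiv ℝ F j.1 ((0, 1, uX j.1), uTX j, uXX j)

end TotalDerivatives

/-! A vector field `Q = ξ^t ∂_t + ξ^x ∂_x + η ∂_ψ + η* ∂_ψ*` is given by the function
`(ξ^t, ξ^x, η)`; the coefficients `ξ^t, ξ^x` are real and `η*` is the complex conjugate of `η`. -/

/-- The coefficient `ξ^t`. -/
def xiT (Q : J0 → J0) (p : J0) : ℝ := (Q p).1

/-- The coefficient `ξ^x`. -/
def xiX (Q : J0 → J0) (p : J0) : ℝ := (Q p).2.1

/-- The coefficient `η`. -/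
def eta (Q : J0 → J0) (p : J0) : ℂ := (Q p).2.2

/-- `η^t = D_t η - (D_t ξ^t) ψ_t - (D_t ξ^x) ψ_x`. -/
def etaT (Q : J0 → J0) (j : J1) : ℂ :=
  totalT0 (eta Q) j - totalT0 (xiT Q) j • uT j - totalT0 (xiX Q) j • uX j

/-- `η^x = D_x η - (D_x ξ^t) ψ_t - (D_x ξ^x) ψ_x`. -/
def etaX (Q : J0 → J0) (j : J1) : ℂ :=
  totalX0 (eta Q) j - totalX0 (xiT Q) j • uT j - totalX0 (xiX Q) j • uX j

/-- `η^tt = D_t η^t - (D_t ξ^t) ψ_tt - (D_t ξ^x) ψ_tx`. -/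
def etaTT (Q : J0 → J0) (j : J2) : ℂ :=
  totalT1 (etaT Q) j - totalT0 (xiT Q) j.1 • uTT j - totalT0 (xiX Q) j.1 • uTX j

/-- `η^tx = D_x η^t - (D_x ξ^t) ψ_tt - (D_x ξ^x) ψ_tx`. -/
def etaTX (Q : J0 → J0) (j : J2) : ℂ :=
  totalX1 (etaT Q) j - totalX0 (xiT Q) j.1 • uTT j - totalX0 (xiX Q) j.1 • uTX j

/-- `η^xx = D_x η^x - (D_x ξ^t) ψ_tx - (D_x ξ^x) ψ_xx`. -/
def etaXX (Q : J0 → J0) (j : J2) : ℂ :=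
  totalX1 (etaX Q) j - totalX0 (xiT Q) j.1 • uTX j - totalX0 (xiX Q) j.1 • uXX j

/-- The second prolongation of the vector field `Q`, a vector field on the second jet space. -/
def prolong (Q : J0 → J0) (j : J2) : J2 :=
  ((Q j.1.1, etaT Q j.1, etaX Q j.1), etaTT Q j, etaTX Q j, etaXX Q j)

/-- The left-hand side `i ψ_t + ψ_xx + ψ² ψ* + V(t, x) ψ` of the equation, as a function on the
second jet space. -/
def schr (V : ℝ × ℝ → ℂ) (j : J2) : ℂ :=
  Complex.I * uT j.1 + uXX j + j.1.1.2.2 ^ 2 * conj j.1.1.2.2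
    + V (j.1.1.1, j.1.1.2.1) * j.1.1.2.2

/-- The set of all `(t, x)` with `(t, x, ψ) ∈ Ω` for some `ψ`. -/
def baseDomain (Ω : Set J0) : Set (ℝ × ℝ) := (fun p : J0 => (p.1, p.2.1)) '' Ω

/-- The smooth vector fields on `Ω`.  Such a field is represented by its extension by `0` to the
whole space, so that two of them are equal exactly if they agree on `Ω`. -/
def smoothFields (Ω : Set J0) : Set (J0 → J0) :=
  {Q | ContDiffOn ℝ ∞ Q Ω ∧ ∀ p, p ∉ Ω → Q p = 0}

/-- The maximal Lie invariance algebra `A^max(V)` over the domain `Ω`: all smooth vector fields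
whose second prolongation annihilates the left-hand side of the equation at every point of the
manifold which the equation defines in the second jet space over `Ω`. -/
def maxLieInvarianceAlgebra (Ω : Set J0) (V : ℝ × ℝ → ℂ) : Set (J0 → J0) :=
  {Q | Q ∈ smoothFields Ω ∧
    ∀ j : J2, j.1.1 ∈ Ω → schr V j = 0 → fderiv ℝ (schr V) j (prolong Q j) = 0}

/-- The kernel `A^ker` of the class: the intersection of the algebras `A^max(V)` over all smooth
complex-valued potentials `V`. -/
def kernelAlgebra (Ω : Set J0) : Set (J0 → J0) :=
  ⋂ V ∈ {V : ℝ × ℝ → ℂ | ContDiffOn ℝ ∞ V (baseDomain Ω)}, maxLieInvarianceAlgebra Ω V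

/-- The vector field `M = i (ψ ∂_ψ - ψ* ∂_ψ*)` on `Ω`. -/
def fieldM (Ω : Set J0) : J0 → J0 :=
  Ω.indicator fun p => (0, 0, Complex.I * p.2.2)

end CubicSchrodinger

end

open scoped ContDiff ComplexConjugate

namespace CubicSchrodinger

/-! Since V is arbitrary, its value v and differential L at a point are free parameters, next to ψ_t
and ψ_x; the equation itself only fixes ψ_xx. Splitting in L gives ξ^t = ξ^x = 0
(`xi_eq_zero_of_mem_kernel`). Splitting in ψ_t, ψ_x and v (`split_determining_equation`) gives η =
aψ with a = `etaPsi Q`, a_ψ = a_ψ* = a_x = 0, and the remainder a_t = 2i Re(a)|ψ|². Hence Re a is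
constant, and equality of mixed derivatives in t and ψ forces Re a = 0, so a is an imaginary
constant (`exists_eta_eq`). Conversely, M only rotates the phase, under which every term of the
equation has weight one. -/

lemma isOpen_baseDomain {Ω : Set J0} (hΩ : IsOpen Ω) : IsOpen (baseDomain Ω) := by
  have h : IsOpenMap (fun p : J0 => (p.1, p.2.1)) :=
    IsOpenMap.id.prodMap (isOpenMap_fst (X := ℝ) (Y := ℂ))
  exact h _ hΩ

/-- The differential of the left-hand side of the equation. -/
lemma fderiv_schr {V : ℝ × ℝ → ℂ} {j : J2}
    (hV : DifferentiableAt ℝ V (j.1.1.1, j.1.1.2.1)) (w : J2) :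
    fderiv ℝ (schr V) j w = Complex.I * uT w.1 + uXX w
      + (2 * j.1.1.2.2 * conj j.1.1.2.2 * w.1.1.2.2 + j.1.1.2.2 ^ 2 * conj w.1.1.2.2)
      + (V (j.1.1.1, j.1.1.2.1) * w.1.1.2.2
        + fderiv ℝ V (j.1.1.1, j.1.1.2.1) (w.1.1.1, w.1.1.2.1) * j.1.1.2.2) := by
  let cψ : J2 →L[ℝ] ℂ := (ContinuousLinearMap.snd ℝ ℝ ℂ).comp
    ((ContinuousLinearMap.snd ℝ ℝ (ℝ × ℂ)).comp
      ((ContinuousLinearMap.fst ℝ J0 (ℂ × ℂ)).comp (ContinuousLinearMap.fst ℝ J1 (ℂ × ℂ × ℂ))))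
  let cb : J2 →L[ℝ] ℝ × ℝ := ((ContinuousLinearMap.fst ℝ ℝ (ℝ × ℂ)).prod
      ((ContinuousLinearMap.fst ℝ ℝ ℂ).comp (ContinuousLinearMap.snd ℝ ℝ (ℝ × ℂ)))).comp
      ((ContinuousLinearMap.fst ℝ J0 (ℂ × ℂ)).comp (ContinuousLinearMap.fst ℝ J1 (ℂ × ℂ × ℂ)))
  let cT : J2 →L[ℝ] ℂ := (ContinuousLinearMap.fst ℝ ℂ ℂ).comp
    ((ContinuousLinearMap.snd ℝ J0 (ℂ × ℂ)).comp (ContinuousLinearMap.fst ℝ J1 (ℂ × ℂ × ℂ)))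
  let cXX : J2 →L[ℝ] ℂ := (ContinuousLinearMap.snd ℝ ℂ ℂ).comp
    ((ContinuousLinearMap.snd ℝ ℂ (ℂ × ℂ)).comp (ContinuousLinearMap.snd ℝ J1 (ℂ × ℂ × ℂ)))
  have hψ : HasFDerivAt (fun j : J2 => cψ j) cψ j := cψ.hasFDerivAt
  have hconj : HasFDerivAt (fun j : J2 => conj (cψ j))
      ((Complex.conjCLE : ℂ →L[ℝ] ℂ).comp cψ) j :=
    ((Complex.conjCLE : ℂ →L[ℝ] ℂ).comp cψ).hasFDerivAt
  have hVb : HasFDerivAt (fun j : J2 => V (cb j))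
      ((fderiv ℝ V (j.1.1.1, j.1.1.2.1)).comp cb) j :=
    HasFDerivAt.comp (g := V) j hV.hasFDerivAt cb.hasFDerivAt
  have h := (((cT.hasFDerivAt (x := j)).const_mul Complex.I).add (cXX.hasFDerivAt (x := j))).add
    ((hψ.mul hψ).mul hconj) |>.add (hVb.mul hψ)
  have he : schr V = fun j => Complex.I * cT j + cXX j + cψ j * cψ j * conj (cψ j)
      + V (cb j) * cψ j := by
    funext j
    simp only [schr, cT, cXX, cψ, cb, pow_two]
    rfl
  rw [he]
  erw [h.fderiv]
  simp [cT, cXX, cψ, cb]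
  ring

lemma mem_baseDomain {Ω : Set J0} {p : J0} (hp : p ∈ Ω) : (p.1, p.2.1) ∈ baseDomain Ω :=
  ⟨p, hp, rfl⟩

/-- Ω may meet ψ = 0; identities obtained by cancelling ψ extend there by continuity. -/
lemma dense_psi_ne_zero : Dense {p : J0 | p.2.2 ≠ 0} :=
  (dense_compl_singleton (0 : ℂ)).preimage
    ((isOpenMap_snd (X := ℝ) (Y := ℂ)).comp (isOpenMap_snd (X := ℝ) (Y := ℝ × ℂ)))

/-- A continuous function on an open set of `J0` that vanishes where `ψ ≠ 0` vanishes. -/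
lemma eq_zero_of_eq_zero_of_psi_ne_zero {E : Type*} [TopologicalSpace E] [T1Space E] [Zero E]
    {Ω : Set J0} (hΩ : IsOpen Ω) {f : J0 → E}
    (hf : ContinuousOn f Ω) (h : ∀ p ∈ Ω, p.2.2 ≠ 0 → f p = 0) {p : J0} (hp : p ∈ Ω) :
    f p = 0 := by
  by_contra hne
  have ho : IsOpen (Ω ∩ f ⁻¹' {0}ᶜ) := hf.isOpen_inter_preimage hΩ isOpen_compl_singleton
  obtain ⟨q, hq, hq0⟩ := dense_psi_ne_zero.inter_open_nonempty _ ho ⟨p, hp, hne⟩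
  exact hq.2 (h q hq.1 hq0)

/-! ### The 1-jet of the potential as a free parameter. -/

section Smooth

variable {Ω : Set J0} {Q : J0 → J0}

lemma contDiffOn_eta (hQ : ContDiffOn ℝ ∞ Q Ω) : ContDiffOn ℝ ∞ (eta Q) Ω :=
  (contDiff_snd.comp contDiff_snd).comp_contDiffOn hQ

/-- The invariance criterion for all potentials, in the form needed below. -/
lemma invariance_of_mem_kernel (hQ : Q ∈ kernelAlgebra Ω) {j : J2}
    (hj : j.1.1 ∈ Ω) (v : ℂ) (L : ℝ × ℝ →L[ℝ] ℂ)
    (hv : Complex.I * uT j.1 + uXX j + j.1.1.2.2 ^ 2 * conj j.1.1.2.2 + v * j.1.1.2.2 = 0) :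
    Complex.I * etaT Q j.1 + etaXX Q j
      + (2 * j.1.1.2.2 * conj j.1.1.2.2 * eta Q j.1.1 + j.1.1.2.2 ^ 2 * conj (eta Q j.1.1))
      + (v * eta Q j.1.1 + L (xiT Q j.1.1, xiX Q j.1.1) * j.1.1.2.2) = 0 := by
  set b : ℝ × ℝ := (j.1.1.1, j.1.1.2.1) with hb
  -- An affine potential realises any prescribed value and differential at b.
  have hVd : HasFDerivAt (fun y : ℝ × ℝ => v + L (y - b)) L b := by
    simpa using (L.hasFDerivAt.sub_const (L b)).const_add v
  have hVs : ContDiff ℝ ∞ (fun y : ℝ × ℝ => v + L (y - b)) := by fun_prop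
  have hmem := Set.mem_iInter₂.1 hQ _ hVs.contDiffOn
  have h := hmem.2 j hj (by simpa [schr, hb] using hv)
  rw [fderiv_schr hVd.differentiableAt, ← hb, hVd.fderiv] at h
  simpa [prolong, xiT, xiX, eta] using h

lemma mem_smoothFields_of_mem_kernel (hQ : Q ∈ kernelAlgebra Ω) : Q ∈ smoothFields Ω :=
  (Set.mem_iInter₂.1 hQ (fun _ => 0) contDiffOn_const).1

/-- Only the term L(ξ^t, ξ^x)ψ involves L, so comparing L with 0 at the same jet isolates it. -/
lemma xi_eq_zero_of_mem_kernel (hΩ : IsOpen Ω) (hQ : Q ∈ kernelAlgebra Ω) {p : J0} (hp : p ∈ Ω) :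
    xiT Q p = 0 ∧ xiX Q p = 0 := by
  have hc := (mem_smoothFields_of_mem_kernel hQ).1.continuousOn
  have hcT : ContinuousOn (xiT Q) Ω := continuous_fst.comp_continuousOn hc
  have hcX : ContinuousOn (xiX Q) Ω := (continuous_fst.comp continuous_snd).comp_continuousOn hc
  have key : ∀ L : ℝ × ℝ →L[ℝ] ℂ, ∀ q ∈ Ω, q.2.2 ≠ 0 → L (xiT Q q, xiX Q q) = 0 := by
    intro L q hq hq0
    -- With all derivatives of ψ zero, v = -|ψ|² solves the equation.
    have h := fun L => invariance_of_mem_kernel hQ (j := ((q, 0, 0), 0, 0, 0)) hq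
      (-(q.2.2 * conj q.2.2)) L (by simp; ring)
    have h1 := h L
    have h0 := h 0
    simp only [zero_apply, zero_mul, add_zero] at h0
    have : L (xiT Q q, xiX Q q) * q.2.2 = 0 := by linear_combination h1 - h0
    exact (mul_eq_zero.1 this).resolve_right hq0
  constructor
  · refine eq_zero_of_eq_zero_of_psi_ne_zero hΩ hcT (fun q hq hq0 => ?_) hp
    simpa using key (Complex.ofRealCLM.comp (ContinuousLinearMap.fst ℝ ℝ ℝ)) q hq hq0
  · refine eq_zero_of_eq_zero_of_psi_ne_zero hΩ hcX (fun q hq hq0 => ?_) hp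
    simpa using key (Complex.ofRealCLM.comp (ContinuousLinearMap.snd ℝ ℝ ℝ)) q hq hq0

/-! ### Prolongation of vertical fields. -/

lemma fderiv_eq_zero_of_eqOn_zero {f : J0 → ℝ} (hΩ : IsOpen Ω) (h : ∀ p ∈ Ω, f p = 0) {p : J0}
    (hp : p ∈ Ω) : fderiv ℝ f p = 0 := by
  have : f =ᶠ[nhds p] fun _ => (0 : ℝ) := Filter.eventually_of_mem (hΩ.mem_nhds hp) h
  rw [this.fderiv_eq]
  simp

lemma etaT_eq (hΩ : IsOpen Ω) (hT : ∀ p ∈ Ω, xiT Q p = 0) (hX : ∀ p ∈ Ω, xiX Q p = 0)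
    {j : J1} (hj : j.1 ∈ Ω) : etaT Q j = fderiv ℝ (eta Q) j.1 (1, 0, uT j) := by
  simp [etaT, totalT0, fderiv_eq_zero_of_eqOn_zero hΩ hT hj, fderiv_eq_zero_of_eqOn_zero hΩ hX hj]

lemma etaX_eq (hΩ : IsOpen Ω) (hT : ∀ p ∈ Ω, xiT Q p = 0) (hX : ∀ p ∈ Ω, xiX Q p = 0)
    {j : J1} (hj : j.1 ∈ Ω) : etaX Q j = fderiv ℝ (eta Q) j.1 (0, 1, uX j) := by
  simp [etaX, totalX0, fderiv_eq_zero_of_eqOn_zero hΩ hT hj, fderiv_eq_zero_of_eqOn_zero hΩ hX hj]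

/-- The second-order coefficient `η^xx` of a vertical vector field. -/
lemma etaXX_eq (hΩ : IsOpen Ω) (hQ : ContDiffOn ℝ ∞ Q Ω) (hT : ∀ p ∈ Ω, xiT Q p = 0)
    (hX : ∀ p ∈ Ω, xiX Q p = 0) {j : J2} (hj : j.1.1 ∈ Ω) :
    etaXX Q j = fderiv ℝ (fderiv ℝ (eta Q)) j.1.1 (0, 1, uX j.1) (0, 1, uX j.1)
      + fderiv ℝ (eta Q) j.1.1 (0, 0, uXX j) := by
  have he : etaX Q =ᶠ[nhds j.1] fun k => fderiv ℝ (eta Q) k.1 (0, 1, uX k) :=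
    Filter.eventually_of_mem ((hΩ.preimage continuous_fst).mem_nhds hj)
      fun k hk => etaX_eq hΩ hT hX hk
  have hη : ContDiffAt ℝ ∞ (eta Q) j.1.1 := (contDiffOn_eta hQ).contDiffAt (hΩ.mem_nhds hj)
  have hd : DifferentiableAt ℝ (fderiv ℝ (eta Q)) j.1.1 :=
    (hη.fderiv_right (m := ∞) (by simp)).differentiableAt (by simp)
  have h1 : HasFDerivAt (fun k : J1 => fderiv ℝ (eta Q) k.1)
      ((fderiv ℝ (fderiv ℝ (eta Q)) j.1.1).comp (ContinuousLinearMap.fst ℝ J0 (ℂ × ℂ))) j.1 :=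
    HasFDerivAt.comp (g := fderiv ℝ (eta Q)) j.1 hd.hasFDerivAt hasFDerivAt_fst
  have h2 : HasFDerivAt (fun k : J1 => ((0, 1, uX k) : J0))
      ((0 : J1 →L[ℝ] ℝ).prod ((0 : J1 →L[ℝ] ℝ).prod
        ((ContinuousLinearMap.snd ℝ ℂ ℂ).comp (ContinuousLinearMap.snd ℝ J0 (ℂ × ℂ))))) j.1 :=
    (hasFDerivAt_const _ _).prodMk ((hasFDerivAt_const _ _).prodMk
      ((ContinuousLinearMap.snd ℝ ℂ ℂ).comp
        (ContinuousLinearMap.snd ℝ J0 (ℂ × ℂ))).hasFDerivAt)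
  have h3 := (h1.clm_apply h2).fderiv
  rw [etaXX, totalX1, he.fderiv_eq, h3]
  simp [totalX0, fderiv_eq_zero_of_eqOn_zero hΩ hT hj, fderiv_eq_zero_of_eqOn_zero hΩ hX hj]
  ring

/-! ### The determining equation and its splitting. -/

/-- The determining equation for the coefficient `η` of an element of the kernel algebra, with
`ψ_t`, `ψ_x` and the value `v` of the potential as independent parameters. -/
lemma determining_equation (hΩ : IsOpen Ω) (hQ : Q ∈ kernelAlgebra Ω) {p : J0} (hp : p ∈ Ω)
    (y w v : ℂ) :
    Complex.I * fderiv ℝ (eta Q) p (1, 0, y)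
      + fderiv ℝ (fderiv ℝ (eta Q)) p (0, 1, w) (0, 1, w)
      - fderiv ℝ (eta Q) p (0, 0, Complex.I * y + p.2.2 ^ 2 * conj p.2.2 + v * p.2.2)
      + 2 * p.2.2 * conj p.2.2 * eta Q p + p.2.2 ^ 2 * conj (eta Q p) + v * eta Q p = 0 := by
  have hT : ∀ q ∈ Ω, xiT Q q = 0 := fun q hq => (xi_eq_zero_of_mem_kernel hΩ hQ hq).1
  have hX : ∀ q ∈ Ω, xiX Q q = 0 := fun q hq => (xi_eq_zero_of_mem_kernel hΩ hQ hq).2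
  set s := Complex.I * y + p.2.2 ^ 2 * conj p.2.2 + v * p.2.2 with hs
  have h := invariance_of_mem_kernel hQ (j := ((p, y, w), 0, 0, -s)) hp v 0
    (by simp only [hs]; ring)
  rw [etaT_eq hΩ hT hX hp, etaXX_eq hΩ (mem_smoothFields_of_mem_kernel hQ).1 hT hX hp] at h
  have hneg : fderiv ℝ (eta Q) p (0, 0, -s) = -fderiv ℝ (eta Q) p (0, 0, s) := by
    rw [← map_neg]; simp
  simp only [zero_apply, hneg] at h
  linear_combination h

/-- The derivative of `η` in the direction of the real part of `ψ`. -/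
noncomputable def etaPsi (Q : J0 → J0) (p : J0) : ℂ := fderiv ℝ (eta Q) p (0, 0, 1)

lemma contDiffAt_etaPsi (hΩ : IsOpen Ω) (hQ : ContDiffOn ℝ ∞ Q Ω) {p : J0} (hp : p ∈ Ω) :
    ContDiffAt ℝ ∞ (etaPsi Q) p := by
  have hη : ContDiffAt ℝ ∞ (eta Q) p := (contDiffOn_eta hQ).contDiffAt (hΩ.mem_nhds hp)
  exact (hη.fderiv_right (m := ∞) (by simp)).clm_apply contDiffAt_const

lemma fderiv_etaPsi (hΩ : IsOpen Ω) (hQ : ContDiffOn ℝ ∞ Q Ω) {p : J0} (hp : p ∈ Ω) (v : J0) :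
    fderiv ℝ (etaPsi Q) p v = fderiv ℝ (fderiv ℝ (eta Q)) p v (0, 0, 1) := by
  have hη : ContDiffAt ℝ ∞ (eta Q) p := (contDiffOn_eta hQ).contDiffAt (hΩ.mem_nhds hp)
  have hd : DifferentiableAt ℝ (fderiv ℝ (eta Q)) p :=
    (hη.fderiv_right (m := ∞) (by simp)).differentiableAt (by simp)
  have := (hd.hasFDerivAt.clm_apply (hasFDerivAt_const ((0, 0, 1) : J0) p)).fderiv
  unfold etaPsi
  rw [this]
  simp

/-- Splitting the determining equation with respect to `ψ_t`, `ψ_x` and the potential. -/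
lemma split_determining_equation (hΩ : IsOpen Ω) (hQ : Q ∈ kernelAlgebra Ω) {p : J0}
    (hp : p ∈ Ω) :
    eta Q p = etaPsi Q p * p.2.2 ∧
    (∀ w : ℂ, fderiv ℝ (etaPsi Q) p (0, 0, w) = 0) ∧
    fderiv ℝ (etaPsi Q) p (0, 1, 0) = 0 ∧
    Complex.I * fderiv ℝ (eta Q) p (1, 0, 0)
      + fderiv ℝ (fderiv ℝ (eta Q)) p (0, 1, 0) (0, 1, 0)
      + p.2.2 ^ 2 * conj p.2.2 * (etaPsi Q p + conj (etaPsi Q p)) = 0 := by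
  have hQs := (mem_smoothFields_of_mem_kernel hQ).1
  have hη : ContDiffAt ℝ ∞ (eta Q) p := (contDiffOn_eta hQs).contDiffAt (hΩ.mem_nhds hp)
  have hsymm : IsSymmSndFDerivAt ℝ (eta Q) p := hη.isSymmSndFDerivAt
      (by simpa using WithTop.coe_le_coe.2 (le_top : (2 : ℕ∞) ≤ ⊤))
  have hdet := determining_equation hΩ hQ hp
  set A : J0 →L[ℝ] ℂ := fderiv ℝ (eta Q) p with hA
  set B : J0 →L[ℝ] J0 →L[ℝ] ℂ := fderiv ℝ (fderiv ℝ (eta Q)) p with hB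
  have h1 : ∀ y : ℂ, ((1, 0, y) : J0) = (1, 0, 0) + (0, 0, y) := by intro y; simp
  have h2 : ∀ w : ℂ, ((0, 1, w) : J0) = (0, 1, 0) + (0, 0, w) := by intro y; simp
  have h3 : ∀ y z : ℂ, ((0, 0, y + z) : J0) = (0, 0, y) + (0, 0, z) := by intro y z; simp
  have h4 : ∀ y : ℂ, ((0, 0, -y) : J0) = -(0, 0, y) := by intro y; simp
  have h5 : ((0, 0, 0) : J0) = 0 := rfl
  have hs : ∀ u v, B u v = B v u := fun u v => hsymm u v
  -- The coefficient of ψ_t is the Cauchy–Riemann equation: η does not depend on ψ*.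
  have hA1 : A (0, 0, Complex.I) = Complex.I * A (0, 0, 1) := by
    have e1 := hdet 1 0 0
    have e0 := hdet 0 0 0
    rw [h1 1] at e1
    simp only [h3, map_add, mul_one, mul_zero, zero_mul, h5, map_zero] at e1 e0
    linear_combination e0 - e1
  have hAw : ∀ w : ℂ, A (0, 0, w) = etaPsi Q p * w := by
    intro w
    have hw : ((0, 0, w) : J0) = w.re • (0, 0, 1) + w.im • (0, 0, Complex.I) := by
      simp [Complex.re_add_im]
    rw [hw, map_add, map_smul, map_smul, hA1, etaPsi, ← hA, Complex.real_smul, Complex.real_smul]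
    conv_rhs => rw [← Complex.re_add_im w]
    ring
  -- The coefficient of v.
  have heta : eta Q p = etaPsi Q p * p.2.2 := by
    have e1 := hdet 0 0 1
    have e0 := hdet 0 0 0
    rw [hAw] at e1 e0
    linear_combination e1 - e0
  -- The even and odd parts in w = ψ_x vanish separately.
  have hBw : ∀ w : ℂ, B (0, 0, w) (0, 0, w) = 0 ∧ B (0, 0, w) (0, 1, 0) = 0 := by
    intro w
    have e1 := hdet 0 w 0
    have e2 := hdet 0 (-w) 0
    have e0 := hdet 0 0 0
    rw [h2 w] at e1
    rw [h2 (-w), h4] at e2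
    simp only [map_add, map_neg, add_apply, neg_apply]
      at e1 e2
    rw [hs (0, 1, 0) (0, 0, w)] at e1 e2
    constructor
    · linear_combination (e1 + e2) / 2 - e0
    · linear_combination (e1 - e2) / 4
  refine ⟨heta, fun w => ?_, ?_, ?_⟩
  · rw [fderiv_etaPsi hΩ hQs hp, ← hB]
    -- Polarization: the quadratic form vanishes at w, 1 and w + 1, hence B(w, 1) = 0.
    have e := (hBw (w + 1)).1
    rw [h3] at e
    simp only [map_add, add_apply, (hBw w).1, (hBw 1).1] at e
    rw [hs (0, 0, 1) (0, 0, w)] at e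
    linear_combination e / 2
  · rw [fderiv_etaPsi hΩ hQs hp, ← hB, hs]
    exact (hBw 1).2
  · have e0 := hdet 0 0 0
    rw [hAw, heta] at e0
    simp only [map_mul] at e0
    linear_combination e0

/-! ### Integration of the split equations. -/

/-- The derivative of `η_ψ` in terms of its real part. -/
lemma fderiv_etaPsi_of_mem_kernel (hΩ : IsOpen Ω) (hQ : Q ∈ kernelAlgebra Ω) {p : J0}
    (hp : p ∈ Ω) (v : J0) :
    fderiv ℝ (etaPsi Q) p v =
      Complex.I * (2 * v.1 * (etaPsi Q p).re * (p.2.2 * conj p.2.2)) := by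
  have hQs := (mem_smoothFields_of_mem_kernel hQ).1
  have ha : ∀ q ∈ Ω, ContDiffAt ℝ ∞ (etaPsi Q) q := fun q hq => contDiffAt_etaPsi hΩ hQs hq
  have hsplit := fun q (hq : q ∈ Ω) => split_determining_equation hΩ hQ hq
  have hdη : ∀ q ∈ Ω, ∀ v : J0, fderiv ℝ (eta Q) q v
      = etaPsi Q q * v.2.2 + q.2.2 * fderiv ℝ (etaPsi Q) q v := by
    intro q hq v
    have he : eta Q =ᶠ[nhds q] fun r => etaPsi Q r * r.2.2 :=
      Filter.eventually_of_mem (hΩ.mem_nhds hq) fun r hr => (hsplit r hr).1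
    have hψ : HasFDerivAt (fun r : J0 => r.2.2)
        ((ContinuousLinearMap.snd ℝ ℝ ℂ).comp (ContinuousLinearMap.snd ℝ ℝ (ℝ × ℂ))) q :=
      ((ContinuousLinearMap.snd ℝ ℝ ℂ).comp
        (ContinuousLinearMap.snd ℝ ℝ (ℝ × ℂ))).hasFDerivAt
    have hm := (((ha q hq).differentiableAt (by simp)).hasFDerivAt.mul hψ).fderiv
    rw [he.fderiv_eq]
    erw [hm]
    simp
  -- From η = aψ and a_x = 0, η_x vanishes on all of Ω and can be differentiated again.
  have hxx : ∀ q ∈ Ω, fderiv ℝ (fderiv ℝ (eta Q)) q (0, 1, 0) (0, 1, 0) = 0 := by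
    intro q hq
    have hη : ContDiffAt ℝ ∞ (eta Q) q := (contDiffOn_eta hQs).contDiffAt (hΩ.mem_nhds hq)
    have hd : DifferentiableAt ℝ (fderiv ℝ (eta Q)) q :=
      (hη.fderiv_right (m := ∞) (by simp)).differentiableAt (by simp)
    have h1 := (hd.hasFDerivAt.clm_apply (hasFDerivAt_const ((0, 1, 0) : J0) q)).fderiv
    have he : (fun r => fderiv ℝ (eta Q) r (0, 1, 0)) =ᶠ[nhds q] fun _ => 0 :=
      Filter.eventually_of_mem (hΩ.mem_nhds hq) fun r hr => by
        simp [hdη r hr, (hsplit r hr).2.2.1]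
    rw [he.fderiv_eq] at h1
    have h2 := congrArg (fun L : J0 →L[ℝ] ℂ => L (0, 1, 0)) h1
    simpa using h2.symm
  have ht : ∀ q ∈ Ω, fderiv ℝ (etaPsi Q) q (1, 0, 0)
      - Complex.I * (2 * (etaPsi Q q).re * (q.2.2 * conj q.2.2)) = 0 := by
    intro q hq
    refine eq_zero_of_eq_zero_of_psi_ne_zero (f := fun q => fderiv ℝ (etaPsi Q) q (1, 0, 0)
      - Complex.I * (2 * (etaPsi Q q).re * (q.2.2 * conj q.2.2))) hΩ ?_ ?_ hq
    · intro r hr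
      have c1 : ContinuousAt (fderiv ℝ (etaPsi Q)) r :=
        ((ha r hr).fderiv_right (m := 0) (by simp)).continuousAt
      have c2 : ContinuousAt (etaPsi Q) r := (ha r hr).continuousAt
      have c3 : ContinuousAt (fun q => ((etaPsi Q q).re : ℂ)) r :=
        (Complex.continuous_ofReal.comp Complex.continuous_re).continuousAt.comp c2
      have c4 : Continuous fun q : J0 => q.2.2 * conj q.2.2 := by fun_prop
      exact ((c1.clm_apply continuousAt_const).sub (continuousAt_const.mul
        ((continuousAt_const.mul c3).mul c4.continuousAt))).continuousWithinAt
    · intro r hr hr0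
      have e := (hsplit r hr).2.2.2
      rw [hxx r hr, hdη r hr, Complex.add_conj] at e
      have hI : Complex.I ^ 2 = -1 := Complex.I_sq
      have e' : r.2.2 * (fderiv ℝ (etaPsi Q) r (1, 0, 0)
          - Complex.I * (2 * (etaPsi Q r).re * (r.2.2 * conj r.2.2))) = 0 := by
        push_cast at e
        simp only [mul_zero, zero_add, add_zero] at e
        linear_combination (-Complex.I) * e + r.2.2 * fderiv ℝ (etaPsi Q) r (1, 0, 0) * hI
      exact (mul_eq_zero.1 e').resolve_left hr0
  have hv : v = v.1 • ((1, 0, 0) : J0) + (v.2.1 • ((0, 1, 0) : J0) + (0, 0, v.2.2)) := by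
    ext <;> simp
  obtain ⟨-, hw, hx, -⟩ := hsplit p hp
  have e := ht p hp
  conv_lhs => rw [hv]
  rw [map_add, map_add, map_smul, map_smul, hw, hx, Complex.real_smul]
  simp only [smul_zero, add_zero]
  linear_combination (v.1 : ℂ) * e

lemma exists_psi_ne_zero (hΩ : IsOpen Ω) (hne : Ω.Nonempty) : ∃ p ∈ Ω, p.2.2 ≠ 0 :=
  dense_psi_ne_zero.inter_open_nonempty Ω hΩ hne

lemma exists_eta_eq (hΩ : IsOpen Ω) (hΩc : IsConnected Ω) (hQ : Q ∈ kernelAlgebra Ω) :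
    ∃ c : ℝ, ∀ p ∈ Ω, eta Q p = c * (Complex.I * p.2.2) := by
  have hQs := (mem_smoothFields_of_mem_kernel hQ).1
  have ha : ∀ q ∈ Ω, ContDiffAt ℝ ∞ (etaPsi Q) q := fun q hq => contDiffAt_etaPsi hΩ hQs hq
  have hD := fun q (hq : q ∈ Ω) => fderiv_etaPsi_of_mem_kernel hΩ hQ hq
  -- Every directional derivative of a is i times a real number.
  have hre : ∀ q ∈ Ω, HasFDerivAt (fun r => (etaPsi Q r).re) (0 : J0 →L[ℝ] ℝ) q := by
    intro q hq
    have h := Complex.reCLM.hasFDerivAt.comp q ((ha q hq).differentiableAt (by simp)).hasFDerivAt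
    refine h.congr_fderiv ?_
    refine ContinuousLinearMap.ext fun v => ?_
    simp [hD q hq, Complex.mul_conj]
  obtain ⟨p₀, hp₀, hψ₀⟩ := exists_psi_ne_zero hΩ hΩc.nonempty
  have hrec : ∀ q ∈ Ω, (etaPsi Q q).re = (etaPsi Q p₀).re := fun q hq =>
    hΩ.is_const_of_fderiv_eq_zero hΩc.isPreconnected
      (fun r hr => (hre r hr).differentiableAt.differentiableWithinAt)
      (fun r hr => (hre r hr).fderiv) hq hp₀
  set c : ℝ := (etaPsi Q p₀).re with hc
  -- Here a_ψ = a_ψ* = 0 while a_t = 2ic|ψ|². Along the radial direction ψ₀ the derivative of a_t is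
  -- 4ic|ψ₀|², which symmetry of the second derivative forces to be 0.
  have hc0 : c = 0 := by
    have hsymm : IsSymmSndFDerivAt ℝ (etaPsi Q) p₀ := (ha p₀ hp₀).isSymmSndFDerivAt
      (by simpa using WithTop.coe_le_coe.2 (le_top : (2 : ℕ∞) ≤ ⊤))
    have hd : DifferentiableAt ℝ (fderiv ℝ (etaPsi Q)) p₀ :=
      ((ha p₀ hp₀).fderiv_right (m := ∞) (by simp)).differentiableAt (by simp)
    have happly : ∀ v, fderiv ℝ (fun q => fderiv ℝ (etaPsi Q) q v) p₀
        = (fderiv ℝ (fderiv ℝ (etaPsi Q)) p₀).flip v := by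
      intro v
      rw [(hd.hasFDerivAt.clm_apply (hasFDerivAt_const v p₀)).fderiv]
      refine ContinuousLinearMap.ext fun w => ?_
      simp
    have e1 : fderiv ℝ (fderiv ℝ (etaPsi Q)) p₀ (1, 0, 0) (0, 0, p₀.2.2) = 0 := by
      have he : (fun q => fderiv ℝ (etaPsi Q) q (0, 0, p₀.2.2)) =ᶠ[nhds p₀] fun _ => 0 :=
        Filter.eventually_of_mem (hΩ.mem_nhds hp₀) fun r hr => by simp [hD r hr]
      have h := happly (0, 0, p₀.2.2)
      rw [he.fderiv_eq] at h
      simpa using (congrArg (fun L : J0 →L[ℝ] ℂ => L (1, 0, 0)) h).symm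
    have e2 : fderiv ℝ (fderiv ℝ (etaPsi Q)) p₀ (0, 0, p₀.2.2) (1, 0, 0)
        = Complex.I * 2 * c * (2 * (p₀.2.2 * conj p₀.2.2)) := by
      have he : (fun q => fderiv ℝ (etaPsi Q) q (1, 0, 0)) =ᶠ[nhds p₀]
          fun q => (Complex.I * 2 * c) * (q.2.2 * conj q.2.2) :=
        Filter.eventually_of_mem (hΩ.mem_nhds hp₀) fun r hr => by
          simp only [hD r hr, hrec r hr]
          push_cast
          ring
      let cψ : J0 →L[ℝ] ℂ :=
        (ContinuousLinearMap.snd ℝ ℝ ℂ).comp (ContinuousLinearMap.snd ℝ ℝ (ℝ × ℂ))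
      have hψ : HasFDerivAt (fun q : J0 => q.2.2) cψ p₀ := cψ.hasFDerivAt
      have hconj : HasFDerivAt (fun q : J0 => conj q.2.2)
          ((Complex.conjCLE : ℂ →L[ℝ] ℂ).comp cψ) p₀ :=
        ((Complex.conjCLE : ℂ →L[ℝ] ℂ).comp cψ).hasFDerivAt
      have h := happly (1, 0, 0)
      have hm := ((hψ.mul hconj).const_mul (Complex.I * 2 * c)).fderiv
      rw [he.fderiv_eq] at h
      erw [hm] at h
      have h' := (congrArg (fun L : J0 →L[ℝ] ℂ => L (0, 0, p₀.2.2)) h).symm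
      simp [cψ] at h'
      rw [h']
      ring
    have e3 := hsymm (1, 0, 0) (0, 0, p₀.2.2)
    rw [e1, e2] at e3
    simpa [hψ₀] using e3.symm
  have hconst : ∀ q ∈ Ω, etaPsi Q q = etaPsi Q p₀ := fun q hq =>
    hΩ.is_const_of_fderiv_eq_zero hΩc.isPreconnected
      (fun r hr => ((ha r hr).differentiableAt (by simp)).differentiableWithinAt)
      (fun r hr => ContinuousLinearMap.ext fun v => by simp [hD r hr, hrec r hr, hc0]) hq hp₀
  refine ⟨(etaPsi Q p₀).im, fun p hp => ?_⟩
  rw [(split_determining_equation hΩ hQ hp).1, hconst p hp]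
  conv_lhs => rw [← Complex.re_add_im (etaPsi Q p₀), ← hc, hc0]
  push_cast
  ring

/-! ### The converse inclusion. -/

lemma contDiffOn_smul_fieldM (c : ℝ) : ContDiffOn ℝ ∞ (c • fieldM Ω) Ω := by
  have h : ContDiff ℝ ∞ fun p : J0 => c • ((0, 0, Complex.I * p.2.2) : J0) := by fun_prop
  refine h.contDiffOn.congr fun p hp => ?_
  simp [fieldM, hp]

/-- The prolonged field multiplies the left-hand side of the equation by ic, whatever V is, so it
vanishes on the solution manifold. -/
lemma smul_fieldM_mem_kernel (hΩ : IsOpen Ω) (c : ℝ) : c • fieldM Ω ∈ kernelAlgebra Ω := by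
  set Q := c • fieldM Ω with hQdef
  have hQs : ContDiffOn ℝ ∞ Q Ω := contDiffOn_smul_fieldM c
  have hQ : ∀ p ∈ Ω, Q p = (0, 0, c * (Complex.I * p.2.2)) := by
    intro p hp
    simp [Q, fieldM, hp]
  have hT : ∀ p ∈ Ω, xiT Q p = 0 := fun p hp => by simp [xiT, hQ p hp]
  have hX : ∀ p ∈ Ω, xiX Q p = 0 := fun p hp => by simp [xiX, hQ p hp]
  let L : J0 →L[ℝ] ℂ := (c * Complex.I) • (ContinuousLinearMap.snd ℝ ℝ ℂ).comp
    (ContinuousLinearMap.snd ℝ ℝ (ℝ × ℂ))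
  have hL : ∀ v, L v = c * Complex.I * v.2.2 := fun v => by simp [L]
  have hη : ∀ p ∈ Ω, eta Q =ᶠ[nhds p] L := fun p hp =>
    Filter.eventually_of_mem (hΩ.mem_nhds hp) fun q hq => by
      simp [eta, hQ q hq, hL]; ring
  have hdη : ∀ p ∈ Ω, fderiv ℝ (eta Q) p = L := fun p hp => by
    rw [(hη p hp).fderiv_eq, L.fderiv]
  have hddη : ∀ p ∈ Ω, fderiv ℝ (fderiv ℝ (eta Q)) p = 0 := fun p hp => by
    have : fderiv ℝ (eta Q) =ᶠ[nhds p] fun _ => L :=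
      Filter.eventually_of_mem (hΩ.mem_nhds hp) hdη
    rw [this.fderiv_eq]
    simp
  refine Set.mem_iInter₂.2 fun V hV => ⟨⟨hQs, fun p hp => by simp [Q, fieldM, hp]⟩, ?_⟩
  intro j hj hjV
  have hVd : DifferentiableAt ℝ V (j.1.1.1, j.1.1.2.1) :=
    (hV.contDiffAt ((isOpen_baseDomain hΩ).mem_nhds (mem_baseDomain hj))).differentiableAt
      (by simp)
  rw [fderiv_schr hVd]
  simp only [prolong, uT, uXX]
  rw [etaT_eq hΩ hT hX hj, etaXX_eq hΩ hQs hT hX hj, hdη _ hj, hddη _ hj, hQ _ hj, hL, hL]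
  simp only [schr, uT, uXX] at hjV
  have h0 : (((0, 0) : ℝ × ℝ)) = 0 := rfl
  simp only [zero_apply, map_mul, Complex.conj_I, Complex.conj_ofReal, h0,
    map_zero]
  linear_combination (c * Complex.I) * hjV

lemma fieldM_ne_zero {Ω : Set J0} (hΩ : IsOpen Ω) (hne : Ω.Nonempty) : fieldM Ω ≠ 0 := by
  obtain ⟨p, hp, hψ⟩ := exists_psi_ne_zero hΩ hne
  intro h
  have := congrFun h p
  simp [fieldM, hp, hψ] at this

end Smooth

end CubicSchrodinger

theorem theorem2 (Ω : Set CubicSchrodinger.J0) (hΩo : IsOpen Ω) (hΩc : IsConnected Ω) :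
    CubicSchrodinger.kernelAlgebra Ω =
        (Submodule.span ℝ {CubicSchrodinger.fieldM Ω} : Set (CubicSchrodinger.J0 → CubicSchrodinger.J0)) ∧
      Module.finrank ℝ (Submodule.span ℝ {CubicSchrodinger.fieldM Ω}) = 1 := by
  refine ⟨?_, finrank_span_singleton (CubicSchrodinger.fieldM_ne_zero hΩo hΩc.nonempty)⟩
  ext Q
  rw [SetLike.mem_coe, Submodule.mem_span_singleton]
  constructor
  · intro hQ
    obtain ⟨c, hc⟩ := CubicSchrodinger.exists_eta_eq hΩo hΩc hQ
    refine ⟨c, funext fun p => ?_⟩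
    by_cases hp : p ∈ Ω
    · obtain ⟨hT, hX⟩ := CubicSchrodinger.xi_eq_zero_of_mem_kernel hΩo hQ hp
      have hη := hc p hp
      simp only [CubicSchrodinger.xiT, CubicSchrodinger.xiX, CubicSchrodinger.eta] at hT hX hη
      refine Prod.ext ?_ (Prod.ext ?_ ?_)
      · simp [CubicSchrodinger.fieldM, hp, hT]
      · simp [CubicSchrodinger.fieldM, hp, hX]
      · simp [CubicSchrodinger.fieldM, hp, hη]
    · simp [CubicSchrodinger.fieldM, hp, (CubicSchrodinger.mem_smoothFields_of_mem_kernel hQ).2 p hp]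
  · rintro ⟨c, rfl⟩
    exact CubicSchrodinger.smul_fieldM_mem_kernel hΩo c
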